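/- All vector spaces are real. A \emph{locally solid lattice} $(X,\varsigma)$ is a vector lattice with a Hausdorff vector topology that has a base at zero of solid sets. For a sequence in a vector lattice, $x_n\downarrow 0$ means that it is decreasing with infimum $0$. A locally solid lattice $(Y,\tau)$ is \emph{$\sigma$-Lebesgue} if $y_n\downarrow 0$ in $Y$ implies $y_n\xrightarrow{\tau}0$; a linear operator $T$ from a vector lattice $X$ to a topological vector space $(Y,\tau)$ is \emph{$\sigma$-Lebesgue} if $x_n\downarrow 0$ in $X$ implies $Tx_n\xrightarrow{\tau}0$; it is \emph{positive} (for $Y$ a vector lattice) if $x\ge 0$ implies $Tx\ge 0$. The topological completion $(\hat X,\hat\varsigma)$ of a locally solid lattice $(X,\varsigma)$ is regarded as a locally solid lattice whose positive cone is the closure in $\hat X$ of the positive cone of $X$. \textbf{Theorem.} Let $(X,\varsigma)$ be a metrizable locally solid lattice, $(Y,\tau)$ a $\sigma$-Lebesgue locally solid lattice, and $T:X\to Y$ a positive, $\varsigma\tau$-continuous, $\sigma$-Lebesgue linear operator. Then $T$ has a unique continuous extension $\hat T:(\hat X,\hat\varsigma)\to(\hat Y,\hat\tau)$ to the topological completions,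 and $\hat T$ is linear, positive, $\hat\varsigma\hat\tau$-continuous and $\sigma$-Lebesgue (i.e. $\hat x_n\downarrow 0$ in $\hat X$ implies $\hat T\hat x_n\xrightarrow{\hat\tau}0$). -/

import Mathlib

open Filter Topology Set

/-- A topology on a lattice-ordered group is locally solid if zero has a base of
neighbourhoods consisting of solid sets (`|y| ≤ |x|` and `x ∈ V` imply `y ∈ V`).
A *locally solid lattice* is a real vector lattice with a Hausdorff vector topology
which is locally solid. -/
class LocallySolid (E : Type*) [AddCommGroup E] [Lattice E] [TopologicalSpace E] : Prop where
  exists_solid : ∀ U ∈ 𝓝 (0 : E), ∃ V ∈ 𝓝 (0 : E), LatticeOrderedAddCommGroup.IsSolid V ∧ V ⊆ U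

/-- `x n ↓ 0`: the sequence is decreasing with infimum `0`. -/
def DecreasesToZero {E : Type*} [AddCommGroup E] [PartialOrder E] (x : ℕ → E) : Prop :=
  Antitone x ∧ IsGLB (range x) 0

/-- An operator `T` is σ-Lebesgue if `x n ↓ 0` implies `T (x n) → 0`. -/
def IsSigmaLebesgueOperator {E F : Type*} [AddCommGroup E] [PartialOrder E] [Module ℝ E]
    [AddCommGroup F] [TopologicalSpace F] [Module ℝ F] (T : E →ₗ[ℝ] F) : Prop :=
  ∀ x : ℕ → E, DecreasesToZero x → Tendsto (fun n => T (x n)) atTop (𝓝 0)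

/-- A locally solid lattice is σ-Lebesgue if `x n ↓ 0` implies `x n → 0`. -/
def IsSigmaLebesgueLattice (E : Type*) [AddCommGroup E] [PartialOrder E] [TopologicalSpace E] :
    Prop :=
  ∀ x : ℕ → E, DecreasesToZero x → Tendsto x atTop (𝓝 0)

/-- An operator is positive if it maps positive vectors to positive vectors. -/
def IsPositiveOperator {E F : Type*} [AddCommGroup E] [PartialOrder E] [Module ℝ E]
    [AddCommGroup F] [PartialOrder F] [Module ℝ F] (T : E →ₗ[ℝ] F) : Prop :=
  ∀ x : E, 0 ≤ x → 0 ≤ T x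

/-! The topological completion `UniformSpace.Completion E` of a locally solid lattice `E`,
as a locally solid lattice. The group and vector space structures are Mathlib's; the positive
cone is the closure of the positive cone of `E`. -/

namespace LocallySolidCompletion

open UniformSpace UniformSpace.Completion

set_option linter.unusedSectionVars false

variable {E : Type*} [AddCommGroup E] [UniformSpace E] [IsUniformAddGroup E]

/-- Scalar multiplications are uniformly continuous in a topological vector space. This gives
access to Mathlib's vector space structure on the completion. -/
instance uniformContinuousConstSMul_real [Module ℝ E] [ContinuousSMul ℝ E] :
    UniformContinuousConstSMul ℝ E :=
  uniformContinuousConstSMul_of_continuousConstSMul ℝ E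

theorem exists_smul_mem [Module ℝ E] [ContinuousSMul ℝ E] {U : Set (Completion E)}
    (hU : U ∈ 𝓝 (0 : Completion E)) : ∃ B ∈ 𝓝 (0 : ℝ), ∃ N ∈ 𝓝 (0 : Completion E),
      ∀ r ∈ B, ∀ x ∈ N, r • x ∈ U := by
  obtain ⟨W, hW, hWc, hWU⟩ := exists_mem_nhds_isClosed_subset hU
  have h1 : Tendsto (fun p : ℝ × E => ((p.1 • p.2 : E) : Completion E)) (𝓝 (0, 0)) (𝓝 0) :=
    ((continuous_coe E).comp continuous_smul).tendsto' _ _ (by simp [coe_zero])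
  rw [nhds_prod_eq] at h1
  obtain ⟨B, hB, V, hV, hBV⟩ := mem_prod_iff.1 (h1 hW)
  have hcl : closure ((fun x : E => (x : Completion E)) '' V) ∈ 𝓝 (0 : Completion E) := by
    have := (isDenseInducing_coe (α := E)).closure_image_mem_nhds hV
    rwa [coe_zero] at this
  refine ⟨B, hB, _, hcl, fun r hr x hx => ?_⟩
  have hc : IsClosed ((fun x : Completion E => r • x) ⁻¹' W) :=
    hWc.preimage (continuous_const_smul r)
  have hs : (fun x : E => (x : Completion E)) '' V ⊆ (fun x : Completion E => r • x) ⁻¹' W := by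
    rintro _ ⟨a, ha, rfl⟩
    have h2 : ((r • a : E) : Completion E) ∈ W := hBV (mk_mem_prod hr ha)
    rw [Completion.coe_smul] at h2
    exact h2
  exact hWU (closure_minimal hs hc hx)

theorem tendsto_smul_left_zero [Module ℝ E] [ContinuousSMul ℝ E] (m : Completion E) :
    Tendsto (fun r : ℝ => r • m) (𝓝 0) (𝓝 0) := by
  intro U hU
  obtain ⟨V, hV, hVU⟩ := exists_nhds_zero_half hU
  obtain ⟨B, hB, N, hN, hBN⟩ := exists_smul_mem hV
  have hm : Tendsto (fun x : Completion E => m - x) (𝓝 m) (𝓝 0) :=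
    (continuous_const.sub continuous_id).tendsto' _ _ (sub_self m)
  obtain ⟨_, hx, a, rfl⟩ := mem_closure_iff_nhds.1 (denseRange_coe (α := E) m) _ (hm hN)
  have ha : Tendsto (fun r : ℝ => r • (a : Completion E)) (𝓝 0) (𝓝 0) := by
    have h1 : Continuous fun r : ℝ => r • a := continuous_id.smul continuous_const
    have h2 : Tendsto (fun r : ℝ => r • a) (𝓝 0) (𝓝 0) := h1.tendsto' _ _ (zero_smul ℝ a)
    have h3 : Tendsto (fun x : E => (x : Completion E)) (𝓝 0) (𝓝 0) :=
      (continuous_coe E).tendsto' _ _ coe_zero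
    exact (h3.comp h2).congr fun r => Completion.coe_smul r a
  have hV' : ∀ᶠ r : ℝ in 𝓝 0, r • (a : Completion E) ∈ V := ha.eventually_mem hV
  have hB' : ∀ᶠ r : ℝ in 𝓝 0, r ∈ B := hB
  have hU' : ∀ᶠ r : ℝ in 𝓝 0, r • m ∈ U := by
    refine (hV'.and hB').mono fun r hr => ?_
    have h2 : r • (m - (a : Completion E)) ∈ V := hBN r hr.2 _ hx
    have h4 := hVU _ h2 _ hr.1
    rw [← smul_add, sub_add_cancel] at h4
    exact h4
  exact hU'

/-- The completion of a topological vector space is a topological vector space. -/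
instance continuousSMul_real [Module ℝ E] [ContinuousSMul ℝ E] :
    ContinuousSMul ℝ (Completion E) :=
  ContinuousSMul.of_nhds_zero
    (fun U hU => by
      obtain ⟨B, hB, N, hN, h⟩ := exists_smul_mem hU
      exact mem_map.2 (mem_of_superset (prod_mem_prod hB hN) fun p hp => h _ hp.1 _ hp.2))
    tendsto_smul_left_zero
    (fun r => (continuous_const_smul r).tendsto' _ _ (smul_zero r))

variable [Lattice E]

/-- The positive cone of the completion: the closure of the positive cone of `E`. -/
def cone (E : Type*) [AddCommGroup E] [UniformSpace E] [IsUniformAddGroup E] [Lattice E] :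
    Set (Completion E) :=
  closure ((fun x : E => (x : Completion E)) '' {x | 0 ≤ x})

theorem coe_mem_cone {x : E} (hx : 0 ≤ x) : (x : Completion E) ∈ cone E :=
  subset_closure ⟨x, hx, rfl⟩

theorem cone_induction {p : Completion E → Prop} (hc : IsClosed {x | p x})
    (h : ∀ x : E, 0 ≤ x → p x) {x : Completion E} (hx : x ∈ cone E) : p x := by
  refine closure_minimal ?_ hc hx
  rintro _ ⟨y, hy, rfl⟩
  exact h y hy

variable [IsOrderedAddMonoid E]

theorem cone_add {x y : Completion E} (hx : x ∈ cone E) (hy : y ∈ cone E) :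
    x + y ∈ cone E := by
  refine cone_induction (p := fun x => x + y ∈ cone E)
    (isClosed_closure.preimage (by fun_prop)) (fun a ha => ?_) hx
  refine cone_induction (p := fun y => (a : Completion E) + y ∈ cone E)
    (isClosed_closure.preimage (by fun_prop)) (fun b hb => ?_) hy
  rw [← coe_add]
  exact coe_mem_cone (add_nonneg ha hb)

theorem zero_mem_cone : (0 : Completion E) ∈ cone E := by
  have := coe_mem_cone (le_refl (0 : E))
  rwa [coe_zero] at this

variable [LocallySolid E]

theorem uniformContinuous_posPart : UniformContinuous (fun x : E => x ⊔ 0) := by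
  rw [UniformContinuous, uniformity_eq_comap_nhds_zero, tendsto_comap_iff]
  intro U hU
  obtain ⟨V, hV, hs, hVU⟩ := LocallySolid.exists_solid U hU
  refine mem_map.2 (mem_of_superset (preimage_mem_comap hV) ?_)
  rintro ⟨a, b⟩ hab
  exact hVU (hs hab (abs_sup_sub_sup_le_abs b a 0))

/-- The continuous extension of `x ↦ x ⊔ 0` to the completion. -/
noncomputable def posPartExt : Completion E → Completion E :=
  Completion.map (fun x : E => x ⊔ 0)

@[fun_prop]
theorem continuous_posPartExt : Continuous (posPartExt (E := E)) := continuous_map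

theorem posPartExt_coe (x : E) :
    posPartExt (x : Completion E) = ((x ⊔ 0 : E) : Completion E) :=
  map_coe uniformContinuous_posPart x

theorem posPartExt_of_mem {x : Completion E} (hx : x ∈ cone E) : posPartExt x = x := by
  refine cone_induction (p := fun x => posPartExt x = x)
    (isClosed_eq (by fun_prop) (by fun_prop)) (fun a ha => ?_) hx
  rw [posPartExt_coe, sup_eq_left.2 ha]

theorem posPartExt_of_neg_mem {x : Completion E} (hx : -x ∈ cone E) : posPartExt x = 0 := by
  have := cone_induction (p := fun x : Completion E => posPartExt (-x) = 0)
    (isClosed_eq (by fun_prop) (by fun_prop)) (fun a ha => ?_) hx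
  · simpa using this
  · rw [← coe_neg, posPartExt_coe, sup_eq_right.2 (by simpa using ha), coe_zero]

theorem posPartExt_mem (x : Completion E) : posPartExt x ∈ cone E := by
  induction x using Completion.induction_on with
  | hp => exact isClosed_closure.preimage (by fun_prop)
  | ih a => rw [posPartExt_coe]; exact coe_mem_cone le_sup_right

theorem posPartExt_sub_mem (x : Completion E) : posPartExt x - x ∈ cone E := by
  induction x using Completion.induction_on with
  | hp => exact isClosed_closure.preimage (by fun_prop)
  | ih a =>
    rw [posPartExt_coe, ← coe_sub]
    exact coe_mem_cone (sub_nonneg.2 le_sup_left)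

theorem sub_posPartExt_mem {x y : Completion E} (hx : x ∈ cone E) (hy : y ∈ cone E) :
    x - posPartExt (x - y) ∈ cone E := by
  refine cone_induction (p := fun x => x - posPartExt (x - y) ∈ cone E)
    (isClosed_closure.preimage (by fun_prop)) (fun a ha => ?_) hx
  refine cone_induction (p := fun y => (a : Completion E) - posPartExt ((a : Completion E) - y) ∈ cone E)
    (isClosed_closure.preimage (by fun_prop)) (fun b hb => ?_) hy
  rw [← coe_sub, posPartExt_coe, ← coe_sub]
  exact coe_mem_cone (sub_nonneg.2 (sup_le (sub_le_self a hb) ha))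

/-- The order of the completion: `x ≤ y` iff `y - x` lies in the closure of the positive cone
of `E`. -/
instance instPartialOrder : PartialOrder (Completion E) where
  le x y := y - x ∈ cone E
  le_refl x := by simpa using zero_mem_cone
  le_trans x y z hxy hyz := by simpa using cone_add hyz hxy
  le_antisymm x y hxy hyx := by
    have h1 := posPartExt_of_mem hxy
    have h2 := posPartExt_of_neg_mem (x := y - x) (by simpa using hyx)
    exact (sub_eq_zero.1 (h1.symm.trans h2)).symm

theorem le_def {x y : Completion E} : x ≤ y ↔ y - x ∈ cone E := Iff.rfl

theorem nonneg_iff {x : Completion E} : 0 ≤ x ↔ x ∈ cone E := by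
  rw [le_def, sub_zero]

instance instIsOrderedAddMonoid : IsOrderedAddMonoid (Completion E) where
  add_le_add_left x y h z := by
    rw [le_def] at h ⊢
    simpa using h

/-- The lattice operations of the completion. -/
noncomputable instance instLattice : Lattice (Completion E) where
  __ := instPartialOrder
  sup x y := x + posPartExt (y - x)
  inf x y := x - posPartExt (x - y)
  le_sup_left x y := by
    rw [le_def]
    simpa using posPartExt_mem (y - x)
  le_sup_right x y := by
    rw [le_def]
    simpa [add_sub_right_comm, sub_sub_eq_add_sub, add_comm] using posPartExt_sub_mem (y - x)
  sup_le x y z hx hy := by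
    rw [le_def] at hx hy ⊢
    have := sub_posPartExt_mem hx hy
    rwa [sub_sub_sub_cancel_left, sub_sub] at this
  inf_le_left x y := by
    rw [le_def]
    simpa using posPartExt_mem (x - y)
  inf_le_right x y := by
    rw [le_def]
    have := posPartExt_sub_mem (x - y)
    convert this using 1
    abel
  le_inf x y z hx hy := by
    rw [le_def] at hx hy ⊢
    have := sub_posPartExt_mem hx hy
    rwa [sub_sub_sub_cancel_right, sub_right_comm] at this

theorem sup_def (x y : Completion E) : x ⊔ y = x + posPartExt (y - x) := rfl

/-- `E` is a vector sublattice of its completion. -/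
theorem coe_sup (x y : E) : ((x ⊔ y : E) : Completion E) = (x : Completion E) ⊔ y := by
  rw [sup_def, ← coe_sub, posPartExt_coe, ← coe_add, add_sup, add_sub_cancel, add_zero, sup_comm]

/-- The order of the completion restricts to the order of `E`. -/
theorem coe_le_coe [T0Space E] {x y : E} : (x : Completion E) ≤ y ↔ x ≤ y := by
  rw [← sup_eq_right, ← coe_sup, coe_inj, sup_eq_right]

instance instIsOrderedModule [Module ℝ E] [IsOrderedModule ℝ E] [ContinuousSMul ℝ E] :
    IsOrderedModule ℝ (Completion E) :=
  IsOrderedModule.of_smul_nonneg fun r hr x hx => by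
    rw [nonneg_iff] at hx ⊢
    refine cone_induction (p := fun x => r • x ∈ cone E)
      (isClosed_closure.preimage (continuous_const_smul r)) (fun a ha => ?_) hx
    rw [← Completion.coe_smul]
    exact coe_mem_cone (smul_nonneg hr ha)

/-- The topology of the completion is locally solid. -/
instance instLocallySolid : LocallySolid (Completion E) where
  exists_solid U hU := by
    have hsup : Continuous fun p : Completion E × Completion E => p.1 ⊔ p.2 := by
      simp only [sup_def]
      fun_prop
    have habs : Continuous fun x : Completion E => |x| :=
      hsup.comp (continuous_id.prodMk continuous_neg)
    have hinf : Continuous fun p : Completion E × Completion E => p.1 ⊓ p.2 := by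
      have : Continuous fun p : Completion E × Completion E => -(-p.1 ⊔ -p.2) :=
        (hsup.comp (continuous_fst.neg.prodMk continuous_snd.neg)).neg
      simpa [neg_sup] using this
    obtain ⟨W, hW, hWc, hWU⟩ := exists_mem_nhds_isClosed_subset hU
    have hW' : (fun x : E => (x : Completion E)) ⁻¹' W ∈ 𝓝 (0 : E) :=
      (continuous_coe E).continuousAt.preimage_mem_nhds (by rwa [coe_zero])
    obtain ⟨V, hV, hVs, hVW⟩ := LocallySolid.exists_solid _ hW'
    refine ⟨closure ((fun x : E => (x : Completion E)) '' V), ?_, ?_, ?_⟩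
    · have := (isDenseInducing_coe (α := E)).closure_image_mem_nhds hV
      rwa [coe_zero] at this
    · intro x hx y hyx
      have hcl : IsClosed {x : Completion E |
          ∀ y : Completion E,
            (y ⊓ |x|) ⊔ (-|x|) ∈ closure ((fun x : E => (x : Completion E)) '' V)} := by
        rw [ofPred_forall]
        refine isClosed_iInter fun y => isClosed_closure.preimage ?_
        exact hsup.comp ((hinf.comp (continuous_const.prodMk habs)).prodMk habs.neg)
      have key := closure_minimal (t := {x : Completion E |
          ∀ y : Completion E,
            (y ⊓ |x|) ⊔ (-|x|) ∈ closure ((fun x : E => (x : Completion E)) '' V)}) ?_ hcl hx y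
      · rwa [inf_eq_left.2 ((le_abs_self y).trans hyx),
          sup_eq_left.2 (neg_le.1 ((neg_le_abs y).trans hyx))] at key
      · rintro _ ⟨a, ha, rfl⟩ y
        induction y using Completion.induction_on with
        | hp =>
          refine isClosed_closure.preimage ?_
          exact hsup.comp
            ((hinf.comp (continuous_id.prodMk continuous_const)).prodMk continuous_const)
        | ih b =>
          have hab : |(a : Completion E)| = ((|a| : E) : Completion E) := by
            rw [abs, ← coe_neg, ← coe_sup, abs]
          have hin : ∀ u v : E, ((u ⊓ v : E) : Completion E) = (u : Completion E) ⊓ v := by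
            intro u v
            rw [← neg_neg ((u : Completion E) ⊓ v), neg_inf, ← coe_neg, ← coe_neg, ← coe_sup,
              ← coe_neg, neg_sup, neg_neg, neg_neg]
          refine subset_closure ⟨(b ⊓ |a|) ⊔ (-|a|), hVs ha ?_, ?_⟩
          · refine abs_le'.2 ⟨sup_le inf_le_right (neg_le_self (abs_nonneg a)), ?_⟩
            rw [neg_le]
            exact le_sup_right
          · simp only [coe_sup, hin, coe_neg, hab]
    · refine (closure_minimal ?_ hWc).trans hWU
      rintro _ ⟨a, ha, rfl⟩
      exact hVW ha

end LocallySolidCompletion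

namespace LocallySolidCompletion

open UniformSpace UniformSpace.Completion

/-! `T` extends by uniform continuity, and positivity passes to the limit because the cone of the
completion is the closure of the cone of `X`.

The substance is the σ-Lebesgue property. Let `x n ↓ 0` in the completion. Metrizability gives a
base `u n` at zero with `u (n + 1) + u (n + 1) ⊆ u n`; choose positive `a n` in `X` with `|x n - a
n| ∈ u n`. The running infima of a tail of `a` decrease in `X`, have infimum zero there
(`isGLB_zero_of_tendsto_abs_sub`), and differ from the corresponding `x n` by at most a finite sum
of errors, hence by little, uniformly in `n` (`exists_decreasesToZero_sub_mem`). The extension then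
sends the small difference into a small set, while `T` sends the sequence in `X` to zero. -/

/-- The completion of a first countable uniform group is first countable. -/
theorem firstCountableTopology_completion {E : Type*} [AddCommGroup E] [UniformSpace E]
    [IsUniformAddGroup E] [FirstCountableTopology E] : FirstCountableTopology (Completion E) := by
  obtain ⟨v, hv⟩ := (𝓝 (0 : E)).exists_antitone_basis
  have hb : (𝓝 (0 : Completion E)).HasBasis (fun _ : ℕ => True)
      fun n => closure ((fun x : E => (x : Completion E)) '' v n) := by
    refine ⟨fun U => ⟨fun hU => ?_, ?_⟩⟩
    · obtain ⟨W, hW, hWc, hWU⟩ := exists_mem_nhds_isClosed_subset hU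
      have hW' : (fun x : E => (x : Completion E)) ⁻¹' W ∈ 𝓝 (0 : E) :=
        (continuous_coe E).continuousAt.preimage_mem_nhds (by rwa [coe_zero])
      obtain ⟨n, -, hn⟩ := hv.1.mem_iff.1 hW'
      exact ⟨n, trivial, (closure_minimal (image_subset_iff.2 hn) hWc).trans hWU⟩
    · rintro ⟨n, -, hn⟩
      refine mem_of_superset ?_ hn
      have := (isDenseInducing_coe (α := E)).closure_image_mem_nhds (hv.1.mem_of_mem (i := n) trivial)
      rwa [coe_zero] at this
  have : (𝓝 (0 : Completion E)).IsCountablyGenerated :=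
    HasCountableBasis.isCountablyGenerated ⟨hb, to_countable _⟩
  have : (uniformity (Completion E)).IsCountablyGenerated :=
    IsUniformAddGroup.uniformity_countably_generated
  infer_instance

/-- Finite sums of a sequence with `e k ∈ u k` stay in `u m` if `u (n + 1) + u (n + 1) ⊆ u n`. -/
theorem sum_range_mem {G : Type*} [AddCommMonoid G] {u : ℕ → Set G} (h0 : ∀ n, (0 : G) ∈ u n)
    (hu : ∀ n, ∀ a ∈ u (n + 1), ∀ b ∈ u (n + 1), a + b ∈ u n) {e : ℕ → G} (he : ∀ n, e n ∈ u n)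
    (n m : ℕ) : ∑ j ∈ Finset.range n, e (m + 1 + j) ∈ u m := by
  induction n generalizing m with
  | zero => simpa using h0 m
  | succ n ih =>
    -- The first term is split off, not the last: it lies in `u (m + 1)`, and so does the rest, by
    -- induction at `m + 1`.
    rw [Finset.sum_range_succ']
    refine hu m _ ?_ _ (he _)
    simpa [add_assoc, add_comm, add_left_comm] using ih (m + 1)

variable {E : Type*} [AddCommGroup E] [Lattice E] [IsOrderedAddMonoid E] [UniformSpace E]
  [IsUniformAddGroup E] [LocallySolid E]

theorem isClosed_nonneg : IsClosed {x : Completion E | 0 ≤ x} := by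
  simp only [nonneg_iff]
  exact isClosed_closure

/-- A positive element of the completion is approximated by positive elements of `E`. -/
theorem exists_nonneg_abs_sub_mem {x : Completion E} (hx : 0 ≤ x) {U : Set (Completion E)}
    (hU : U ∈ 𝓝 0) : ∃ a : E, 0 ≤ a ∧ |x - a| ∈ U := by
  obtain ⟨V, hV, hVs, hVU⟩ := LocallySolid.exists_solid U hU
  have hm : Tendsto (fun y : Completion E => x - y) (𝓝 x) (𝓝 0) :=
    (continuous_const.sub continuous_id).tendsto' _ _ (sub_self x)
  obtain ⟨_, hy, a, ha, rfl⟩ := mem_closure_iff_nhds.1 (nonneg_iff.1 hx) _ (hm hV)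
  exact ⟨a, ha, hVU (hVs hy (abs_abs _).le)⟩

/-- If a decreasing sequence of infimum zero in the completion is asymptotic to a sequence of
positive elements of `E`, then zero is the infimum in `E` of the latter. -/
theorem isGLB_zero_of_tendsto_abs_sub [T0Space E] {x : ℕ → Completion E} (hx : DecreasesToZero x)
    {a : ℕ → E} (ha : ∀ n, 0 ≤ a n) (h : Tendsto (fun n => |x n - a n|) atTop (𝓝 0)) (m : ℕ) :
    IsGLB (range fun n => a (m + n)) 0 := by
  refine ⟨forall_mem_range.2 fun n => ha _, fun z hz => ?_⟩
  rw [← coe_le_coe, coe_zero]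
  refine hx.2.2 (forall_mem_range.2 fun j => ?_)
  -- For `n ≥ j`, monotonicity gives `z ≤ a n ≤ x j + |x n - a n|`. As `n → ∞` the error vanishes,
  -- and closedness of the cone yields `z ≤ x j`.
  have hlim : Tendsto (fun n => x j - (z : Completion E) + |x n - a n|) atTop
      (𝓝 (x j - z + 0)) := h.const_add _
  rw [add_zero] at hlim
  refine sub_nonneg.1 (isClosed_nonneg.mem_of_tendsto hlim ?_)
  filter_upwards [eventually_ge_atTop j, eventually_ge_atTop m] with n hj hm
  have h1 : z ≤ a n := hz ⟨n - m, by simp [Nat.add_sub_cancel' hm]⟩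
  have h2 : (a n : Completion E) - x n ≤ |x n - a n| := by
    rw [abs_sub_comm]
    exact le_abs_self _
  have h3 : (z : Completion E) ≤ x j + |x n - a n| :=
    calc (z : Completion E) ≤ a n := coe_le_coe.2 h1
      _ = x n + (a n - x n) := (add_sub_cancel _ _).symm
      _ ≤ x j + |x n - a n| := add_le_add (hx.1 hj) h2
  change 0 ≤ x j - (z : Completion E) + |x n - a n|
  rwa [sub_add_eq_add_sub, sub_nonneg]

theorem coe_inf (x y : E) : ((x ⊓ y : E) : Completion E) = (x : Completion E) ⊓ y := by
  rw [← neg_neg ((x : Completion E) ⊓ y), neg_inf, ← coe_neg, ← coe_neg, ← coe_sup, ← coe_neg,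
    neg_sup, neg_neg, neg_neg]

/-- A decreasing sequence of infimum zero in the completion of a first countable locally solid
lattice is, up to an error in a prescribed neighbourhood of zero, a decreasing sequence of infimum
zero in the lattice. -/
theorem exists_decreasesToZero_sub_mem [T0Space E] [FirstCountableTopology E]
    {x : ℕ → Completion E} (hx : DecreasesToZero x) {U : Set (Completion E)} (hU : U ∈ 𝓝 0) :
    ∃ (y : ℕ → E) (m : ℕ), DecreasesToZero y ∧ ∀ n, x (m + n) - y n ∈ U := by
  have := firstCountableTopology_completion (E := E)
  obtain ⟨u, hu, hadd⟩ := IsTopologicalAddGroup.exists_antitone_basis_nhds_zero (Completion E)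
  have hun : ∀ n, u n ∈ 𝓝 0 := fun n => hu.1.mem_of_mem trivial
  have hx0 : ∀ n, 0 ≤ x n := fun n => hx.2.1 ⟨n, rfl⟩
  choose a ha hau using fun n => exists_nonneg_abs_sub_mem (hx0 n) (hun n)
  obtain ⟨V, hV, hVs, hVU⟩ := LocallySolid.exists_solid U hU
  obtain ⟨m, -, hm⟩ := hu.1.mem_iff.1 hV
  have hlim : Tendsto (fun n => |x n - a n|) atTop (𝓝 0) := hu.tendsto hau
  -- Starting at `m + 1` makes every finite sum of errors land in `u m`.
  have hglb := isGLB_zero_of_tendsto_abs_sub hx ha hlim (m + 1)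
  -- The `a n` need not decrease; their running infima do.
  let y : ℕ → E := fun n =>
    (Finset.range (n + 1)).inf' Finset.nonempty_range_add_one fun j => a (m + 1 + j)
  have hya : ∀ n j, j ≤ n → y n ≤ a (m + 1 + j) := fun n j hj =>
    Finset.inf'_le _ (Finset.mem_range_succ_iff.2 hj)
  refine ⟨y, m + 1, ⟨fun k n hkn => Finset.le_inf' _ _ fun j hj =>
    hya n j ((Finset.mem_range_succ_iff.1 hj).trans hkn), ?_, fun z hz => ?_⟩, fun n => ?_⟩
  · exact forall_mem_range.2 fun n => Finset.le_inf' _ _ fun j _ => ha _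
  · exact hglb.2 (forall_mem_range.2 fun n => (hz ⟨n, rfl⟩).trans (hya n n le_rfl))
  · set s := ∑ j ∈ Finset.range (n + 1), |x (m + 1 + j) - a (m + 1 + j)| with hs
    have hsu : s ∈ u m := sum_range_mem (fun n => mem_of_mem_nhds (hun n))
      (fun n b hb c hc => hadd n (Set.add_mem_add hb hc)) hau (n + 1) m
    have hes : ∀ j ≤ n, |x (m + 1 + j) - a (m + 1 + j)| ≤ s := fun j hj =>
      Finset.single_le_sum (f := fun j => |x (m + 1 + j) - a (m + 1 + j)|)
        (fun _ _ => abs_nonneg _) (Finset.mem_range_succ_iff.2 hj)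
    have hyc : (y n : Completion E) = (Finset.range (n + 1)).inf' Finset.nonempty_range_add_one
        fun j => (a (m + 1 + j) : Completion E) :=
      Finset.apply_inf'_eq_inf'_comp _ (fun x : E => (x : Completion E)) coe_inf
    -- Since `x` decreases, each `a (m + 1 + j)` with `j ≤ n` is at least `x (m + 1 + n) - s`, hence
    -- so is their infimum `y n`. The other bound only needs `y n ≤ a (m + 1 + n)`.
    have hle : |x (m + 1 + n) - y n| ≤ s := by
      refine abs_le'.2 ⟨?_, ?_⟩
      · rw [sub_le_comm, hyc]
        refine Finset.le_inf' _ _ fun j hj => ?_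
        have hj' := Finset.mem_range_succ_iff.1 hj
        rw [sub_le_comm]
        exact (sub_le_sub_right (hx.1 (by omega)) _).trans ((le_abs_self _).trans (hes j hj'))
      · rw [neg_sub]
        refine (sub_le_sub_right (coe_le_coe.2 (hya n n le_rfl)) _).trans ?_
        refine (le_abs_self _).trans ?_
        rw [abs_sub_comm]
        exact hes n le_rfl
    exact hVU (hVs (hm hsu) (hle.trans (le_abs_self s)))

end LocallySolidCompletion

theorem mainTheorem3
    {X Y : Type*}
    -- a metrizable locally solid lattice `X`
    [AddCommGroup X] [Module ℝ X] [Lattice X] [IsOrderedAddMonoid X] [IsOrderedModule ℝ X]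
    [UniformSpace X] [IsUniformAddGroup X] [ContinuousSMul ℝ X] [LocallySolid X]
    [TopologicalSpace.MetrizableSpace X]
    -- a Hausdorff σ-Lebesgue locally solid lattice `Y`
    [AddCommGroup Y] [Module ℝ Y] [Lattice Y] [IsOrderedAddMonoid Y] [IsOrderedModule ℝ Y]
    [UniformSpace Y] [IsUniformAddGroup Y] [ContinuousSMul ℝ Y] [LocallySolid Y]
    [T2Space Y] (hY : IsSigmaLebesgueLattice Y)
    (T : X →ₗ[ℝ] Y) (hTpos : IsPositiveOperator T) (hTcont : Continuous T)
    (hTleb : IsSigmaLebesgueOperator T) :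
    ∃ That : UniformSpace.Completion X →ₗ[ℝ] UniformSpace.Completion Y,
      (∀ x : X, That (x : UniformSpace.Completion X) = (T x : UniformSpace.Completion Y)) ∧
      Continuous That ∧
      (∀ S : UniformSpace.Completion X → UniformSpace.Completion Y, Continuous S →
        (∀ x : X, S (x : UniformSpace.Completion X) = (T x : UniformSpace.Completion Y)) →
        S = That) ∧
      IsPositiveOperator That ∧
      IsSigmaLebesgueOperator That := by
  have hc := T.toAddMonoidHom.continuous_completion hTcont
  -- A continuous additive map between real topological vector spaces is automatically real-linear.
  let L : UniformSpace.Completion X →L[ℝ] UniformSpace.Completion Y :=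
    (T.toAddMonoidHom.completion hTcont).toRealLinearMap hc
  have hL : ∀ x : X, L (x : UniformSpace.Completion X) = (T x : UniformSpace.Completion Y) :=
    fun x => T.toAddMonoidHom.completion_coe hTcont x
  refine ⟨L, hL, L.continuous, fun S hS hST => ?_, fun x hx => ?_, fun x hx => ?_⟩
  · exact UniformSpace.Completion.ext hS L.continuous fun a => (hST a).trans (hL a).symm
  · rw [LocallySolidCompletion.nonneg_iff] at hx
    refine LocallySolidCompletion.cone_induction (p := fun x => 0 ≤ L x)
      (LocallySolidCompletion.isClosed_nonneg.preimage L.continuous) (fun a ha => ?_) hx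
    rw [hL, LocallySolidCompletion.nonneg_iff]
    exact LocallySolidCompletion.coe_mem_cone (hTpos a ha)
  · intro U hU
    obtain ⟨V, hV, hVU⟩ := exists_nhds_zero_half hU
    -- Both `y` and the shift `m` depend on `U`; this is harmless, as convergence is tested one
    -- neighbourhood at a time.
    obtain ⟨y, m, hy, hxy⟩ := LocallySolidCompletion.exists_decreasesToZero_sub_mem hx
      ((L.continuous.tendsto' 0 0 (map_zero L)) hV)
    have hTy : Tendsto (fun n => (T (y n) : UniformSpace.Completion Y)) atTop (𝓝 0) :=
      ((UniformSpace.Completion.continuous_coe Y).tendsto' 0 0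
        UniformSpace.Completion.coe_zero).comp (hTleb y hy)
    have key : ∀ᶠ n in atTop, L (x (m + n)) ∈ U := by
      filter_upwards [hTy.eventually_mem hV] with n hn
      have := hVU _ (hxy n) _ hn
      rwa [← hL, ← map_add, sub_add_cancel] at this
    simp only [add_comm m] at key
    change ∀ᶠ n in atTop, L (x n) ∈ U
    rwa [← map_add_atTop_eq_nat m, eventually_map]
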